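/- Consider the Deffuant model on $\mathbb{Z}$ with probability measures on $[0,1]$ as opinions, compared in the total variation distance $\lVert\rho-\nu\rVert_{\mathrm{TV}}=\sup_A|\rho(A)-\nu(A)|$ (supremum over Borel sets). It has a confidence bound $\theta$ and a convergence parameter $\mu\in(0,\tfrac12]$, and it is defined as follows. Initial opinions: let $\{U(v),\,v\in\mathbb{Z}\}$ be i.i.d. uniform on $[0,1]^2$. If $U(v)=(y,z)$, the initial opinion $\eta_0(v)$ of agent $v$ is the symmetric triangular distribution on the interval with endpoints $y$ and $z$, i.e. the measure with density $$f(x)=\tfrac{2}{|y-z|}\Big(1-\tfrac{2}{|y-z|}\,\big|x-\tfrac{y+z}{2}\big|\Big)^+ .$$ Dynamics: the edges $\langle v,v+1\rangle$, $v\in\mathbb{Z}$, carry i.i.d. Poisson processes (of a common rate $r>0$), independent of the initial opinions. The opinion $\eta_t(v)$ of agent $v$ at time $t$ changes only at events of the Poisson processes on the two edges at $v$. If an event occurs on the edge $\langle v,v+1\rangle$ at time $t$, and $a$ and $b$ are the opinions of $v$ and $v+1$ just before time $t$, then $$\big(\eta_t(v),\eta_t(v+1)\big)=\begin{cases}\big(a+\mu(b-a),\;b+\mu(a-b)\big)&\text{if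 }\lVert a-b\rVert_{\mathrm{TV}}\le\theta,\\(a,b)&\text{otherwise.}\end{cases}$$ Then for every $\theta\in[0,1)$ the system almost surely approaches disagreement: with probability $1$ there are finally blocked edges, i.e. there is an edge $\langle v,v+1\rangle$ such that $\lVert\eta_t(v)-\eta_t(v+1)\rVert_{\mathrm{TV}}>\theta$ for all sufficiently large $t$. -/

import Mathlib

open MeasureTheory ProbabilityTheory Filter Topology

noncomputable section

namespace Deffuant

/-- Total variation distance `sup_A |ρ A - ν A|` of two probability measures on `ℝ`
(supremum over all Borel sets). -/
def tvDist (ρ ν : Measure ℝ) : ℝ :=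
  ⨆ A : {A : Set ℝ // MeasurableSet A}, |ρ.real A.1 - ν.real A.1|

/-- Density of the symmetric triangular distribution on the interval with endpoints `y` and `z`:
`2 / |y - z| * (1 - 2 / |y - z| * |x - (y + z) / 2|)⁺`. -/
def triangularDensity (y z x : ℝ) : ℝ :=
  2 / |y - z| * max (1 - 2 / |y - z| * |x - (y + z) / 2|) 0

/-- The symmetric triangular distribution on the interval with endpoints `p.1 ≠ p.2`.
For `p` in the unit square it is concentrated on `[0, 1]`. -/
def triangularMeasure (p : ℝ × ℝ) : Measure ℝ :=
  volume.withDensity fun x => ENNReal.ofReal (triangularDensity p.1 p.2 x)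

open Classical in
/-- New opinion of an agent with opinion `a` who meets an agent with opinion `b`:
`a + m (b - a) = (1 - m) a + m b` if the distance is at most `θ`, and `a` otherwise. -/
def compromise (θ m : ℝ) (a b : Measure ℝ) : Measure ℝ :=
  if tvDist a b ≤ θ then ENNReal.ofReal (1 - m) • a + ENNReal.ofReal m • b else a

/-- Event times of a point process on `(0, ∞)` with successive waiting times `w 0, w 1, …`.
If the waiting times are i.i.d. exponential with rate `r`, these are the jump times of
a Poisson process with rate `r`. -/
def eventTimes (w : ℕ → ℝ) : Set ℝ :=
  Set.range fun n : ℕ => ∑ i ∈ Finset.range (n + 1), w i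

/-- `η` (time, vertex) is a trajectory of the Deffuant model on the path `ℤ` with confidence
bound `θ` and convergence parameter `m`, started in `ξ`, where `C v` is the set of times at which
a Poisson event occurs on the edge between `v` and `v + 1`. Only times `t ≥ 0` matter. -/
structure IsTrajectory (θ m : ℝ) (ξ : ℤ → Measure ℝ) (C : ℤ → Set ℝ)
    (η : ℝ → ℤ → Measure ℝ) : Prop where
  /-- The initial opinions are given by `ξ`. -/
  initial : ∀ v, η 0 v = ξ v
  /-- An opinion does not change while there is no event on the two edges at the agent. -/
  constant : ∀ v s t, 0 ≤ s → s ≤ t → (∀ r, s < r → r ≤ t → r ∉ C (v - 1) ∧ r ∉ C v) →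
    η t v = η s v
  /-- At an event, the two agents, whose opinions just before are `a` and `b`, interact. -/
  update : ∀ v t, 0 < t → t ∈ C v → ∃ a b : Measure ℝ,
    (∀ᶠ s in 𝓝[<] t, η s v = a ∧ η s (v + 1) = b) ∧
      η t v = compromise θ m a b ∧ η t (v + 1) = compromise θ m b a

/-- The edge between `v` and `v + 1` is finally blocked. -/
def FinallyBlocked (θ : ℝ) (η : ℝ → ℤ → Measure ℝ) (v : ℤ) : Prop :=
  ∀ᶠ t in atTop, θ < tvDist (η t v) (η t (v + 1))

/-- Disagreement: there are finally blocked edges. -/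
def ApproachesDisagreement (θ : ℝ) (η : ℝ → ℤ → Measure ℝ) : Prop :=
  ∃ v : ℤ, FinallyBlocked θ η v

end Deffuant

end

/-!
A vertex is isolated forever if its initial opinion is very concentrated while the opinions around
it charge the same place very little. Fix a short interval `Iic δ` near the left end of the opinion
space. If both endpoints at `v` are at most `δ`, then `η₀(v)` is concentrated on `Iic δ`. Suppose
moreover that on either side of `v`, for every `n ≥ 1`, the nearest `n` agents initially give on
average less mass than `1 - θ` to `Iic δ`. As long as `v` does not change its opinion, each side
evolves on its own, and each encounter there averages two neighbouring masses; since `m ≤ 1 / 2`,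
this keeps all prefix averages below `1 - θ` (`prefix_sum_lt_of_exchange`). In particular the
neighbours of `v` always give less mass than `1 - θ` to `Iic δ`, where `v` has mass `1`, so that
their total variation distance from `v` exceeds `θ`, and indeed `v` never changes. This is
`IsTrajectory.sheltered`. It inducts on the event times up to a given time in a finite block around
`v` whose two outer edges have been silent so far; almost surely such blocks exist, event times are
locally finite, and no two edges have a common event time.

It remains to find such a vertex `v` (`ae_exists_not_crowded`), which concerns the initial opinions
alone. Only agents with an endpoint in `[0, δ]` charge `Iic δ`, and each agent is of this kind with
probability at most `2 δ`. For small `δ`, a Chernoff bound shows that the fraction of such agents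
among `n` given agents is at least `1 - θ` with probability at most `4⁻ⁿ`. So `v` satisfies the
conditions on its neighbours with probability at least `1 / 3`, independently of its own endpoints,
hence all conditions with positive probability. The two Borel-Cantelli lemmas, applied to centres of
disjoint growing blocks, upgrade this to the almost sure existence of such a vertex.
-/

/-! ### Total variation distance, compromises, and the dynamics around a sheltered vertex -/

namespace Deffuant

lemma bddAbove_tvDist (a b : Measure ℝ) [IsProbabilityMeasure a] [IsProbabilityMeasure b] :
    BddAbove (Set.range fun A : {A : Set ℝ // MeasurableSet A} => |a.real A.1 - b.real A.1|) := by
  refine ⟨1, ?_⟩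
  rintro _ ⟨A, rfl⟩
  have h1 : a.real A.1 ≤ 1 := measureReal_le_one
  have h2 : b.real A.1 ≤ 1 := measureReal_le_one
  have h3 : 0 ≤ a.real A.1 := measureReal_nonneg
  have h4 : 0 ≤ b.real A.1 := measureReal_nonneg
  exact abs_le.2 ⟨by linarith, by linarith⟩

lemma abs_sub_le_tvDist (a b : Measure ℝ) [IsProbabilityMeasure a] [IsProbabilityMeasure b]
    {A : Set ℝ} (hA : MeasurableSet A) : |a.real A - b.real A| ≤ tvDist a b :=
  le_ciSup (bddAbove_tvDist a b) ⟨A, hA⟩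

lemma tvDist_comm (a b : Measure ℝ) : tvDist a b = tvDist b a := by
  simp only [tvDist, abs_sub_comm]

/-- The mixture `(1 - m) a + m b` that an opinion `a` becomes in a compromise with `b`. -/
noncomputable def mixture (m : ℝ) (a b : Measure ℝ) : Measure ℝ :=
  ENNReal.ofReal (1 - m) • a + ENNReal.ofReal m • b

lemma compromise_of_le {θ m : ℝ} {a b : Measure ℝ} (h : tvDist a b ≤ θ) :
    compromise θ m a b = mixture m a b := if_pos h

lemma compromise_of_lt {θ m : ℝ} {a b : Measure ℝ} (h : θ < tvDist a b) :
    compromise θ m a b = a := if_neg h.not_ge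

lemma mixture_real {m : ℝ} (h0 : 0 ≤ m) (h1 : m ≤ 1) (a b : Measure ℝ) [IsProbabilityMeasure a]
    [IsProbabilityMeasure b] (A : Set ℝ) :
    (mixture m a b).real A = (1 - m) * a.real A + m * b.real A := by
  simp only [mixture, Measure.real, Measure.add_apply, Measure.smul_apply, smul_eq_mul]
  rw [ENNReal.toReal_add (by finiteness) (by finiteness), ENNReal.toReal_mul, ENNReal.toReal_mul,
    ENNReal.toReal_ofReal (by linarith), ENNReal.toReal_ofReal h0]

lemma isProbabilityMeasure_mixture {m : ℝ} (h0 : 0 ≤ m) (h1 : m ≤ 1) (a b : Measure ℝ)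
    [IsProbabilityMeasure a] [IsProbabilityMeasure b] : IsProbabilityMeasure (mixture m a b) := by
  constructor
  simp only [mixture, Measure.add_apply, Measure.smul_apply, smul_eq_mul, measure_univ, mul_one]
  rw [← ENNReal.ofReal_add (by linarith) h0]
  simp

/-- Averaging two neighbouring values keeps every prefix average below `lam`: only the prefix sum
`S (j + 1)` changes, to `(1 - 2 m) S (j + 1) + m (S j + S (j + 2))`. This is where `m ≤ 1 / 2`
is used. -/
lemma prefix_sum_lt_of_exchange {lam m : ℝ} (hm : m ∈ Set.Ioc (0 : ℝ) (1 / 2)) {N j : ℕ}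
    {x x' : ℕ → ℝ} (hx : ∀ n : ℕ, 1 ≤ n → n ≤ N → ∑ i ∈ Finset.range n, x i < lam * n)
    (hj : j + 1 < N) (hne : ∀ i < N, i ≠ j → i ≠ j + 1 → x' i = x i)
    (h1 : x' j = (1 - m) * x j + m * x (j + 1))
    (h2 : x' (j + 1) = (1 - m) * x (j + 1) + m * x j) :
    ∀ n : ℕ, 1 ≤ n → n ≤ N → ∑ i ∈ Finset.range n, x' i < lam * n := by
  obtain ⟨hm0, hm1⟩ := hm
  have hlow : ∀ n ≤ j, ∑ i ∈ Finset.range n, x' i = ∑ i ∈ Finset.range n, x i := fun n hn =>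
    Finset.sum_congr rfl fun i hi => by
      have := Finset.mem_range.1 hi
      exact hne i (by omega) (by omega) (by omega)
  have hhigh : ∀ n, j + 2 ≤ n → n ≤ N →
      ∑ i ∈ Finset.range n, x' i = ∑ i ∈ Finset.range n, x i := by
    intro n hn
    induction n, hn using Nat.le_induction with
    | base =>
      intro _
      rw [Finset.sum_range_succ, Finset.sum_range_succ, hlow j le_rfl, h1, h2,
        Finset.sum_range_succ, Finset.sum_range_succ]
      ring
    | succ n hn ih =>
      intro hN
      rw [Finset.sum_range_succ, ih (by omega), hne n (by omega) (by omega) (by omega),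
        Finset.sum_range_succ]
  intro n hn1 hnN
  rcases lt_trichotomy n (j + 1) with h | rfl | h
  · rw [hlow n (by omega)]
    exact hx n hn1 hnN
  · have e0 : ∑ i ∈ Finset.range j, x i ≤ lam * j := by
      rcases Nat.eq_zero_or_pos j with rfl | h
      · simp
      · exact (hx j h (by omega)).le
    have e1 := hx (j + 1) (by omega) (by omega)
    have e2 := hx (j + 2) (by omega) (by omega)
    rw [Finset.sum_range_succ, hlow j le_rfl, h1]
    rw [Finset.sum_range_succ] at e1
    rw [Finset.sum_range_succ, Finset.sum_range_succ] at e2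
    push_cast at e1 e2 ⊢
    have f0 := mul_le_mul_of_nonneg_left e0 hm0.le
    have f1 := mul_le_mul_of_nonneg_left e1.le (by linarith : 0 ≤ 1 - 2 * m)
    have f2 := mul_lt_mul_of_pos_left e2 hm0
    nlinarith
  · rw [hhigh n (by omega) hnN]
    exact hx n hn1 hnN

/-- The vertex `v` is sheltered in the block `[v - q, v + p]`: its opinion is concentrated on `I`,
whereas the opinions of the nearest `n` agents on either side within the block give on average less
mass than `lam` to `I`, for every `n`. -/
structure Sheltered (lam : ℝ) (I : Set ℝ) (v : ℤ) (p q : ℕ) (f : ℤ → Measure ℝ) : Prop where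
  isProb : ∀ u, v - q ≤ u → u ≤ v + p → IsProbabilityMeasure (f u)
  centre : (f v).real I = 1
  right : ∀ n : ℕ, 1 ≤ n → n ≤ p → ∑ i ∈ Finset.range n, (f (v + 1 + i)).real I < lam * n
  left : ∀ n : ℕ, 1 ≤ n → n ≤ q → ∑ i ∈ Finset.range n, (f (v - 1 - i)).real I < lam * n

namespace Sheltered

variable {θ m lam : ℝ} {I : Set ℝ} {v : ℤ} {p q : ℕ} {f g : ℤ → Measure ℝ}

lemma congr (h : Sheltered lam I v p q f) (hfg : ∀ u, v - q ≤ u → u ≤ v + p → g u = f u) :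
    Sheltered lam I v p q g where
  isProb u h1 h2 := hfg u h1 h2 ▸ h.isProb u h1 h2
  centre := by rw [hfg v (by omega) (by omega)]; exact h.centre
  right n h1 h2 := by
    convert! h.right n h1 h2 using 1
    exact Finset.sum_congr rfl fun i hi => by
      have := Finset.mem_range.1 hi
      rw [hfg _ (by omega) (by omega)]
  left n h1 h2 := by
    convert! h.left n h1 h2 using 1
    exact Finset.sum_congr rfl fun i hi => by
      have := Finset.mem_range.1 hi
      rw [hfg _ (by omega) (by omega)]

lemma lt_tvDist_right (h : Sheltered (1 - θ) I v p q f) (hI : MeasurableSet I) (hp : 1 ≤ p) :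
    θ < tvDist (f v) (f (v + 1)) := by
  have := h.isProb v (by omega) (by omega)
  have := h.isProb (v + 1) (by omega) (by omega)
  have h1 := h.right 1 le_rfl hp
  have h2 := abs_sub_le_tvDist (f v) (f (v + 1)) hI
  have h3 := le_abs_self ((f v).real I - (f (v + 1)).real I)
  simp only [Finset.range_one, Finset.sum_singleton, Nat.cast_zero, add_zero, Nat.cast_one,
    mul_one] at h1
  linarith [h.centre]

lemma lt_tvDist_left (h : Sheltered (1 - θ) I v p q f) (hI : MeasurableSet I) (hq : 1 ≤ q) :
    θ < tvDist (f (v - 1)) (f v) := by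
  have := h.isProb v (by omega) (by omega)
  have := h.isProb (v - 1) (by omega) (by omega)
  have h1 := h.left 1 le_rfl hq
  have h2 := abs_sub_le_tvDist (f (v - 1)) (f v) hI
  have h3 := neg_le_abs ((f (v - 1)).real I - (f v).real I)
  simp only [Finset.range_one, Finset.sum_singleton, Nat.cast_zero, sub_zero, Nat.cast_one,
    mul_one] at h1
  linarith [h.centre]

/-- Being sheltered is preserved by an encounter on any edge inside the block: the two edges at `v`
are blocked, and the others only average within one side. -/
lemma encounter (h : Sheltered (1 - θ) I v p q f) (hI : MeasurableSet I)
    (hm : m ∈ Set.Ioc (0 : ℝ) (1 / 2)) {k : ℤ} (hk1 : v - q ≤ k) (hk2 : k < v + p)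
    (e1 : g k = compromise θ m (f k) (f (k + 1)))
    (e2 : g (k + 1) = compromise θ m (f (k + 1)) (f k))
    (hne : ∀ u, v - q ≤ u → u ≤ v + p → u ≠ k → u ≠ k + 1 → g u = f u) :
    Sheltered (1 - θ) I v p q g := by
  have hm0 : 0 ≤ m := hm.1.le
  have hm1 : m ≤ 1 := by linarith [hm.2]
  rcases lt_or_ge θ (tvDist (f k) (f (k + 1))) with hlt | hle
  · rw [compromise_of_lt hlt] at e1
    rw [compromise_of_lt (tvDist_comm (f k) _ ▸ hlt)] at e2
    refine h.congr fun u h1 h2 => ?_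
    by_cases hu : u = k
    · rw [hu, e1]
    · by_cases hu' : u = k + 1
      · rw [hu', e2]
      · exact hne u h1 h2 hu hu'
  · rw [compromise_of_le hle] at e1
    rw [compromise_of_le (tvDist_comm (f k) _ ▸ hle)] at e2
    have pk := h.isProb k (by omega) (by omega)
    have pk1 := h.isProb (k + 1) (by omega) (by omega)
    have hkv : k ≠ v := by
      rintro rfl
      exact (h.lt_tvDist_right hI (by omega)).not_ge hle
    have hkv1 : k + 1 ≠ v := by
      intro hv
      have hk : k = v - 1 := by omega
      have := h.lt_tvDist_left hI (by omega)
      rw [← hk, ← hv] at this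
      exact this.not_ge hle
    have r1 : (g k).real I = (1 - m) * (f k).real I + m * (f (k + 1)).real I := by
      rw [e1, mixture_real hm0 hm1]
    have r2 : (g (k + 1)).real I = (1 - m) * (f (k + 1)).real I + m * (f k).real I := by
      rw [e2, mixture_real hm0 hm1]
    refine ⟨fun u h1 h2 => ?_, ?_, ?_, ?_⟩
    · by_cases hu : u = k
      · rw [hu, e1]
        exact isProbabilityMeasure_mixture hm0 hm1 _ _
      · by_cases hu' : u = k + 1
        · rw [hu', e2]
          exact isProbabilityMeasure_mixture hm0 hm1 _ _
        · rw [hne u h1 h2 hu hu']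
          exact h.isProb u h1 h2
    · rw [hne v (by omega) (by omega) hkv.symm hkv1.symm]
      exact h.centre
    · rcases lt_or_gt_of_ne hkv with hlt | hgt
      · intro n h1 h2
        convert! h.right n h1 h2 using 1
        refine Finset.sum_congr rfl fun i hi => ?_
        have := Finset.mem_range.1 hi
        rw [hne _ (by omega) (by omega) (by omega) (by omega)]
      · obtain ⟨j, rfl⟩ : ∃ j : ℕ, k = v + 1 + j := ⟨(k - v - 1).toNat, by omega⟩
        refine prefix_sum_lt_of_exchange (j := j) hm h.right (by omega)
          (fun i hi hij hij' => ?_) ?_ ?_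
        · rw [hne _ (by omega) (by omega) (by omega) (by omega)]
        · simpa only [Nat.cast_add, Nat.cast_one, ← add_assoc] using r1
        · simpa only [Nat.cast_add, Nat.cast_one, ← add_assoc] using r2
    · rcases lt_or_gt_of_ne hkv with hlt | hgt
      · obtain ⟨j, rfl⟩ : ∃ j : ℕ, k = v - 1 - (j + 1 : ℕ) := ⟨(v - k - 2).toNat, by omega⟩
        have hk : v - 1 - ((j + 1 : ℕ) : ℤ) + 1 = v - 1 - j := by push_cast; ring
        rw [hk] at r1 r2
        refine prefix_sum_lt_of_exchange (j := j) hm h.left (by omega)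
          (fun i hi hij hij' => ?_) r2 r1
        rw [hne _ (by omega) (by omega) (by omega) (by omega)]
      · intro n h1 h2
        convert! h.left n h1 h2 using 1
        refine Finset.sum_congr rfl fun i hi => ?_
        have := Finset.mem_range.1 hi
        rw [hne _ (by omega) (by omega) (by omega) (by omega)]

end Sheltered

/-- A sheltered vertex stays sheltered as long as the two edges that bound the block are silent. -/
theorem IsTrajectory.sheltered {θ m T : ℝ} {I : Set ℝ} {v : ℤ} {p q : ℕ} {ξ : ℤ → Measure ℝ}
    {C : ℤ → Set ℝ} {η : ℝ → ℤ → Measure ℝ} (hη : IsTrajectory θ m ξ C η)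
    (hm : m ∈ Set.Ioc (0 : ℝ) (1 / 2)) (hI : MeasurableSet I)
    (hfin : ∀ u, (C u ∩ Set.Ioc 0 T).Finite) (hdisj : ∀ u u', u ≠ u' → Disjoint (C u) (C u'))
    (hp : Disjoint (C (v + p)) (Set.Ioc 0 T)) (hq : Disjoint (C (v - q - 1)) (Set.Ioc 0 T))
    (h0 : Sheltered (1 - θ) I v p q ξ) {t : ℝ} (ht0 : 0 ≤ t) (htT : t ≤ T) :
    Sheltered (1 - θ) I v p q (η t) := by
  classical
  have hEfin : (⋃ u ∈ Set.Icc (v - q - 1) (v + p), C u ∩ Set.Ioc 0 T).Finite :=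
    (Set.finite_Icc _ _).biUnion fun u _ => hfin u
  -- the finitely many event times up to `T` in the block
  set F : Finset ℝ := hEfin.toFinset with hF
  have memF : ∀ x, x ∈ F ↔ ∃ u, v - q - 1 ≤ u ∧ u ≤ v + p ∧ x ∈ C u ∧ 0 < x ∧ x ≤ T := by
    intro x
    simp only [hF, Set.Finite.mem_toFinset, Set.mem_iUnion, exists_prop, Set.mem_inter_iff,
      Set.mem_Icc, Set.mem_Ioc, and_assoc]
  have hconst : ∀ u, v - q ≤ u → u ≤ v + p → ∀ s t, 0 ≤ s → s ≤ t → t ≤ T →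
      (∀ r, s < r → r ≤ t → r ∈ C (u - 1) ∨ r ∈ C u → r ∉ F) → η t u = η s u := by
    intro u h1 h2 s t hs hst htT hno
    refine hη.constant u s t hs hst fun r hr1 hr2 => ⟨fun hC => ?_, fun hC => ?_⟩
    · exact hno r hr1 hr2 (Or.inl hC)
        ((memF r).2 ⟨u - 1, by omega, by omega, hC, by linarith, by linarith⟩)
    · exact hno r hr1 hr2 (Or.inr hC)
        ((memF r).2 ⟨u, by omega, by omega, hC, by linarith, by linarith⟩)
  induction hn : (F.filter (· ≤ t)).card using Nat.strong_induction_on generalizing t with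
  | _ n ih =>
    subst hn
    rcases (F.filter (· ≤ t)).eq_empty_or_nonempty with hemp | hne
    · have h0' : Sheltered (1 - θ) I v p q (η 0) := h0.congr fun u _ _ => hη.initial u
      refine h0'.congr fun u h1 h2 => ?_
      refine hconst u h1 h2 0 t le_rfl ht0 htT fun r _ hr _ hrF => ?_
      have : r ∈ F.filter (· ≤ t) := Finset.mem_filter.2 ⟨hrF, hr⟩
      simp [hemp] at this
    · -- the last event time `s`, on the edge `k`
      set s := (F.filter (· ≤ t)).max' hne with hs
      have hsmem := Finset.max'_mem _ hne
      rw [← hs] at hsmem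
      obtain ⟨hsF, hst⟩ := Finset.mem_filter.1 hsmem
      obtain ⟨k, hk1, hk2, hkC, hs0, hsT⟩ := (memF s).1 hsF
      have hlast : ∀ r, s < r → r ≤ t → r ∉ F := fun r h1 h2 hr =>
        (Finset.le_max' _ r (Finset.mem_filter.2 ⟨hr, h2⟩)).not_gt h1
      have hkp : k ≠ v + p := by
        rintro rfl
        exact Set.disjoint_left.1 hp hkC ⟨hs0, hsT⟩
      have hkq : k ≠ v - q - 1 := by
        rintro rfl
        exact Set.disjoint_left.1 hq hkC ⟨hs0, hsT⟩
      obtain ⟨a, b, hab, ea, eb⟩ := hη.update k s hs0 hkC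
      -- a time `s'` just before `s`, after all earlier events
      obtain ⟨s', ⟨hs'0, hs's⟩, hs'F, hsa, hsb⟩ :
          ∃ s', (0 < s' ∧ s' < s) ∧ (∀ r ∈ F.filter (· < s), r < s') ∧
            η s' k = a ∧ η s' (k + 1) = b := by
        have h1 : ∀ᶠ s' in 𝓝[<] s, 0 < s' ∧ s' < s := Ioo_mem_nhdsLT hs0
        have h2 : ∀ᶠ s' in 𝓝[<] s, ∀ r ∈ F.filter (· < s), r < s' := by
          rw [Filter.eventually_all_finset]
          intro r hr
          filter_upwards [Ioo_mem_nhdsLT (Finset.mem_filter.1 hr).2] with x hx using hx.1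
        exact (h1.and (h2.and hab)).exists
      have hS' : Sheltered (1 - θ) I v p q (η s') := by
        refine ih _ (Finset.card_lt_card ?_) hs'0.le (by linarith) rfl
        refine Finset.ssubset_iff_subset_ne.2 ⟨fun x hx => ?_, fun heq => ?_⟩
        · have := Finset.mem_filter.1 hx
          exact Finset.mem_filter.2 ⟨this.1, by linarith [this.2]⟩
        · rw [← heq] at hsmem
          linarith [(Finset.mem_filter.1 hsmem).2]
      have hS : Sheltered (1 - θ) I v p q (η s) := by
        refine hS'.encounter hI hm (k := k) (by omega) (by omega) (by rw [hsa, hsb, ea])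
          (by rw [hsa, hsb, eb]) fun u h1 h2 huk huk1 => ?_
        refine hconst u h1 h2 s' s hs'0.le hs's.le hsT fun r hr1 hr2 hrC hrF => ?_
        rcases hr2.lt_or_eq with hlt | rfl
        · exact (hs'F r (Finset.mem_filter.2 ⟨hrF, hlt⟩)).not_gt hr1
        · rcases hrC with hrC | hrC
          · exact Set.disjoint_left.1 (hdisj k (u - 1) (by omega)) hkC hrC
          · exact Set.disjoint_left.1 (hdisj k u (by omega)) hkC hrC
      exact hS.congr fun u h1 h2 =>
        hconst u h1 h2 s t hs0.le hst htT fun r hr1 hr2 _ => hlast r hr1 hr2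

end Deffuant

/-! ### Triangular distributions -/

namespace Deffuant

lemma triangularDensity_nonneg (y z x : ℝ) : 0 ≤ triangularDensity y z x := by
  unfold triangularDensity
  positivity

/-- The triangular density vanishes outside the interval spanned by its endpoints. -/
lemma triangularDensity_eq_zero {y z x : ℝ} (hyz : y ≠ z) (hx : x ≤ min y z ∨ max y z ≤ x) :
    triangularDensity y z x = 0 := by
  have hw : 0 < |y - z| := abs_pos.2 (sub_ne_zero.2 hyz)
  have hdist : |y - z| / 2 ≤ |x - (y + z) / 2| := by
    rcases hx with hx | hx
    · have h1 := le_min_iff.1 hx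
      rw [abs_of_nonpos (by linarith : x - (y + z) / 2 ≤ 0)]
      rcases abs_cases (y - z) with h | h <;> linarith
    · have h1 := max_le_iff.1 hx
      rw [abs_of_nonneg (by linarith : 0 ≤ x - (y + z) / 2)]
      rcases abs_cases (y - z) with h | h <;> linarith
  have h2 : 1 ≤ 2 / |y - z| * |x - (y + z) / 2| := by
    rw [div_mul_eq_mul_div, le_div_iff₀ hw]
    linarith
  rw [triangularDensity, max_eq_right (by linarith), mul_zero]

lemma integral_tent : ∫ x : ℝ, max (1 - |x|) 0 = 1 := by
  rw [integral_comp_abs (f := fun x => max (1 - x) 0)]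
  have h1 : ∫ x in Set.Ioi (0 : ℝ), max (1 - x) 0 = ∫ x in Set.Ioc (0 : ℝ) 1, (1 - x) := by
    rw [setIntegral_eq_of_subset_of_forall_sdiff_eq_zero measurableSet_Ioi
      (Set.Ioc_subset_Ioi_self : Set.Ioc (0 : ℝ) 1 ⊆ _)]
    · exact setIntegral_congr_fun measurableSet_Ioc fun x hx => max_eq_left (by linarith [hx.2])
    · intro x hx
      refine max_eq_right ?_
      by_contra! h
      exact hx.2 ⟨hx.1, by linarith⟩
  rw [h1, ← intervalIntegral.integral_of_le zero_le_one]
  rw [intervalIntegral.integral_sub (by simp) (by simp), integral_id]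
  norm_num

lemma integral_triangularDensity {y z : ℝ} (hyz : y ≠ z) : ∫ x, triangularDensity y z x = 1 := by
  have hw : 0 < |y - z| := abs_pos.2 (sub_ne_zero.2 hyz)
  set k := 2 / |y - z| with hk
  have hk0 : 0 < k := by positivity
  have h1 : ∀ x, triangularDensity y z x
      = k * (fun u => max (1 - |k * u|) 0) (x - (y + z) / 2) := by
    intro x
    simp only [triangularDensity, abs_mul, abs_of_pos hk0, ← hk]
  simp_rw [h1]
  rw [integral_const_mul, integral_sub_right_eq_self (fun u => max (1 - |k * u|) 0),
    Measure.integral_comp_mul_left (fun u => max (1 - |u|) 0), integral_tent,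
    abs_of_pos (by positivity)]
  simp [hk0.ne']

lemma isProbabilityMeasure_triangularMeasure {p : ℝ × ℝ} (hp : p.1 ≠ p.2) :
    IsProbabilityMeasure (triangularMeasure p) := by
  constructor
  rw [triangularMeasure, withDensity_apply _ MeasurableSet.univ, Measure.restrict_univ,
    ← ofReal_integral_eq_lintegral_ofReal, integral_triangularDensity hp, ENNReal.ofReal_one]
  · exact .of_integral_ne_zero (by rw [integral_triangularDensity hp]; exact one_ne_zero)
  · exact Eventually.of_forall fun x => triangularDensity_nonneg _ _ x

lemma triangularMeasure_real_Iic_eq_zero {p : ℝ × ℝ} (hp : p.1 ≠ p.2) {δ : ℝ}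
    (h1 : δ < p.1) (h2 : δ < p.2) : (triangularMeasure p).real (Set.Iic δ) = 0 := by
  rw [Measure.real, triangularMeasure, withDensity_apply _ measurableSet_Iic,
    setLIntegral_congr_fun (g := fun _ => 0) measurableSet_Iic, lintegral_zero, ENNReal.toReal_zero]
  intro x hx
  have : x ≤ min p.1 p.2 := le_min (by linarith [Set.mem_Iic.1 hx]) (by linarith [Set.mem_Iic.1 hx])
  simp [triangularDensity_eq_zero hp (Or.inl this)]

lemma triangularMeasure_real_Iic_eq_one {p : ℝ × ℝ} (hp : p.1 ≠ p.2) {δ : ℝ}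
    (h1 : p.1 ≤ δ) (h2 : p.2 ≤ δ) : (triangularMeasure p).real (Set.Iic δ) = 1 := by
  have := isProbabilityMeasure_triangularMeasure hp
  have h0 : (triangularMeasure p).real (Set.Ioi δ) = 0 := by
    rw [Measure.real, triangularMeasure, withDensity_apply _ measurableSet_Ioi,
      setLIntegral_congr_fun (g := fun _ => 0) measurableSet_Ioi, lintegral_zero,
      ENNReal.toReal_zero]
    intro x hx
    have : max p.1 p.2 ≤ x :=
      max_le (by linarith [Set.mem_Ioi.1 hx]) (by linarith [Set.mem_Ioi.1 hx])
    simp [triangularDensity_eq_zero hp (Or.inr this)]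
  rw [← Set.compl_Iic, probReal_compl_eq_one_sub measurableSet_Iic] at h0
  linarith

end Deffuant

/-! ### Crowded prefixes in a family of independent random variables -/

namespace Deffuant

section Families

variable {Ω ι α : Type*} [mα : MeasurableSpace α] {X : ι → Ω → α}

/-- The σ-algebra generated by the random variables `X i` with `i ∈ S`. -/
@[reducible] def sigmaOf (X : ι → Ω → α) (S : Set ι) : MeasurableSpace Ω :=
  ⨆ i ∈ S, MeasurableSpace.comap (X i) mα

lemma sigmaOf_mono {S T : Set ι} (h : S ⊆ T) : sigmaOf X S ≤ sigmaOf X T :=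
  biSup_mono fun _ hi => h hi

lemma measurable_sigmaOf {S : Set ι} {i : ι} (hi : i ∈ S) : Measurable[sigmaOf X S] (X i) :=
  (comap_measurable (X i)).mono (le_iSup₂_of_le i hi le_rfl) le_rfl

variable [mΩ : MeasurableSpace Ω] {P : Measure Ω}

lemma sigmaOf_le (hX : ∀ i, Measurable (X i)) (S : Set ι) : sigmaOf X S ≤ mΩ :=
  iSup₂_le fun i _ => (hX i).comap_le

lemma indep_sigmaOf (hX : ∀ i, Measurable (X i)) (hind : iIndepFun X P) {S T : Set ι}
    (hST : Disjoint S T) : Indep (sigmaOf X S) (sigmaOf X T) P :=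
  indep_iSup_of_disjoint (fun i => (hX i).comap_le) hind hST

/-- Events that depend on pairwise disjoint sets of coordinates are independent. -/
lemma iIndepSet_of_disjoint (hX : ∀ i, Measurable (X i)) (hind : iIndepFun X P)
    {S : ℕ → Set ι} (hS : Pairwise fun k l => Disjoint (S k) (S l)) {D : ℕ → Set Ω}
    (hD : ∀ k, MeasurableSet[sigmaOf X (S k)] (D k)) : iIndepSet D P := by
  have := hind.isProbabilityMeasure
  classical
  refine (iIndepSet_iff_meas_biInter fun k => sigmaOf_le hX _ _ (hD k)).2 fun s => ?_
  induction s using Finset.induction_on with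
  | empty => simp
  | insert a s ha ih =>
    rw [Finset.prod_insert ha, ← ih, Finset.set_biInter_insert]
    refine (Indep_iff _ _ P).1
      (indep_sigmaOf hX hind (S := S a) (T := ⋃ i ∈ s, S i) ?_) _ _ (hD a) ?_
    · rw [Set.disjoint_iUnion₂_right]
      exact fun i hi => hS fun h => ha (h ▸ hi)
    · refine Finset.measurableSet_biInter s fun i hi => ?_
      exact sigmaOf_mono (Set.subset_biUnion_of_mem (u := S) (Finset.mem_coe.2 hi)) _ (hD i)

end Families

section Crowded

variable {Ω α : Type*} [mα : MeasurableSpace α] {X : ℤ → Ω → α} {B C : Set α}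

/-- The event that at least the fraction `lam` of the vertices in `S` have their value in `B`. -/
def crowded (X : ℤ → Ω → α) (B : Set α) (lam : ℝ) (S : Finset ℤ) : Set Ω :=
  {ω | lam * S.card ≤ ∑ u ∈ S, B.indicator (fun _ => (1 : ℝ)) (X u ω)}

lemma measurableSet_crowded (hB : MeasurableSet B) (lam : ℝ) {S : Finset ℤ} {T : Set ℤ}
    (hST : ∀ u ∈ S, u ∈ T) : MeasurableSet[sigmaOf X T] (crowded X B lam S) := by
  have h : Measurable[sigmaOf X T] fun ω => ∑ u ∈ S, B.indicator (fun _ => (1 : ℝ)) (X u ω) :=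
    Finset.measurable_sum _ fun u hu =>
      (measurable_const.indicator hB).comp (measurable_sigmaOf (hST u hu))
  exact h measurableSet_Ici

variable [mΩ : MeasurableSpace Ω] {P : Measure Ω}

/-- Chernoff bound for the number of vertices with values in a rare set. -/
lemma measureReal_crowded_le (hX : ∀ u, Measurable (X u)) (hind : iIndepFun X P)
    (hB : MeasurableSet B) {lam s : ℝ} (hs : 0 ≤ s) (hslam : Real.exp (-s * lam) = 1 / 8)
    (hPB : ∀ u, P.real (X u ⁻¹' B) ≤ Real.exp (-s)) (S : Finset ℤ) :
    P.real (crowded X B lam S) ≤ (1 / 4) ^ S.card := by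
  have := hind.isProbabilityMeasure
  set Y : ℤ → Ω → ℝ := fun u ω => B.indicator (fun _ => (1 : ℝ)) (X u ω) with hY
  have hf : Measurable (B.indicator fun _ => (1 : ℝ)) := measurable_const.indicator hB
  have hYm : ∀ u, Measurable (Y u) := fun u => hf.comp (hX u)
  have hYind : iIndepFun Y P := hind.comp (fun _ => B.indicator fun _ => (1 : ℝ)) fun _ => hf
  have hexp : ∀ u, (fun ω => Real.exp (s * Y u ω))
      = fun ω => 1 + (X u ⁻¹' B).indicator (fun _ => Real.exp s - 1) ω := by
    intro u
    funext ω
    by_cases h : X u ω ∈ B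
    · simp [hY, Set.indicator_of_mem, h]
    · simp [hY, Set.indicator_of_notMem, h]
  have hBm : ∀ u, MeasurableSet (X u ⁻¹' B) := fun u => hX u hB
  have hint : ∀ u, Integrable ((X u ⁻¹' B).indicator fun _ => Real.exp s - 1) P := fun u =>
    (integrable_const _).indicator (hBm u)
  have hmgf : ∀ u, mgf (Y u) P s ≤ 2 := by
    intro u
    have h1 : mgf (Y u) P s = 1 + P.real (X u ⁻¹' B) * (Real.exp s - 1) := by
      rw [mgf, hexp, integral_add (integrable_const _) (hint u), integral_indicator_const _ (hBm u)]
      simp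
    have h2 : P.real (X u ⁻¹' B) * (Real.exp s - 1) ≤ Real.exp (-s) * (Real.exp s - 1) :=
      mul_le_mul_of_nonneg_right (hPB u) (by linarith [Real.one_le_exp hs])
    have h3 : Real.exp (-s) * Real.exp s = 1 := by rw [← Real.exp_add]; simp
    nlinarith [Real.exp_pos (-s)]
  have hsumint : Integrable (fun ω => Real.exp (s * (∑ u ∈ S, Y u) ω)) P :=
    hYind.integrable_exp_mul_sum hYm fun u _ => by
      rw [hexp]
      exact (integrable_const _).add (hint u)
  have hset : crowded X B lam S = {ω | lam * S.card ≤ (∑ u ∈ S, Y u) ω} := by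
    ext ω
    simp [crowded, hY]
  calc P.real (crowded X B lam S)
      ≤ Real.exp (-s * (lam * S.card)) * mgf (∑ u ∈ S, Y u) P s := by
        rw [hset]
        exact measure_ge_le_exp_mul_mgf _ hs hsumint
    _ = (1 / 8) ^ S.card * ∏ u ∈ S, mgf (Y u) P s := by
        rw [hYind.mgf_sum hYm, ← hslam, ← Real.exp_nat_mul]
        ring_nf
    _ ≤ (1 / 8) ^ S.card * 2 ^ S.card := by
        gcongr
        exact (Finset.prod_le_prod (fun u _ => mgf_nonneg) fun u _ => hmgf u).trans_eq (by simp)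
    _ = (1 / 4) ^ S.card := by
        rw [← mul_pow]
        norm_num

/-- The event that, for some prefix length `n + 1` with `n ∈ J`, the nearest `n + 1` vertices to the
right or to the left of `v` are crowded. -/
def crowdedNear (X : ℤ → Ω → α) (B : Set α) (lam : ℝ) (J : Set ℕ) (v : ℤ) : Set Ω :=
  ⋃ n ∈ J, crowded X B lam (Finset.Ioc v (v + (n + 1 : ℕ))) ∪
    crowded X B lam (Finset.Ico (v - (n + 1 : ℕ)) v)

lemma sum_quarter_pow_le (k : ℕ) : ∑ n ∈ Finset.range k, (1 / 4 : ℝ) ^ (n + 1) ≤ 1 / 3 := by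
  suffices h : ∑ n ∈ Finset.range k, (1 / 4 : ℝ) ^ (n + 1) = 1 / 3 - (1 / 4) ^ k / 3 by
    rw [h]
    have : (0 : ℝ) < (1 / 4) ^ k := by positivity
    linarith
  induction k with
  | zero => simp
  | succ k ih =>
    rw [Finset.sum_range_succ, ih]
    ring

/-- With positive probability, bounded below uniformly in `k`, the value at `v` is in `C` and no
prefix of length at most `k` is crowded. -/
lemma le_measureReal_sdiff_crowdedNear (hX : ∀ u, Measurable (X u)) (hind : iIndepFun X P)
    (hB : MeasurableSet B) (hC : MeasurableSet C) {lam s : ℝ} (hs : 0 ≤ s)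
    (hslam : Real.exp (-s * lam) = 1 / 8) (hPB : ∀ u, P.real (X u ⁻¹' B) ≤ Real.exp (-s))
    (k : ℕ) (v : ℤ) :
    P.real (X v ⁻¹' C) / 3 ≤ P.real (X v ⁻¹' C \ crowdedNear X B lam (Set.Iio k) v) := by
  have := hind.isProbabilityMeasure
  set c := P.real (X v ⁻¹' C)
  have hc : 0 ≤ c := measureReal_nonneg
  have hone : ∀ S : Finset ℤ, v ∉ S →
      P.real (X v ⁻¹' C ∩ crowded X B lam S) ≤ c * (1 / 4) ^ S.card := by
    intro S hS
    have hind' : Indep (sigmaOf X {v}) (sigmaOf X (S : Set ℤ)) P :=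
      indep_sigmaOf hX hind (by simpa using hS)
    have h1 := (Indep_iff _ _ P).1 hind' _ _ (measurable_sigmaOf (Set.mem_singleton v) hC)
      (measurableSet_crowded (X := X) hB lam (S := S) fun u hu => hu)
    rw [Measure.real, h1, ENNReal.toReal_mul]
    exact mul_le_mul_of_nonneg_left (measureReal_crowded_le hX hind hB hs hslam hPB S) hc
  have hbad : P.real (X v ⁻¹' C ∩ crowdedNear X B lam (Set.Iio k) v) ≤ c * (2 / 3) := by
    calc P.real (X v ⁻¹' C ∩ crowdedNear X B lam (Set.Iio k) v)
        ≤ P.real (⋃ n ∈ Finset.range k,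
            (X v ⁻¹' C ∩ crowded X B lam (Finset.Ioc v (v + (n + 1 : ℕ)))) ∪
            (X v ⁻¹' C ∩ crowded X B lam (Finset.Ico (v - (n + 1 : ℕ)) v))) := by
          refine measureReal_mono ?_ (measure_ne_top _ _)
          rintro ω ⟨h1, h2⟩
          simp only [crowdedNear, Set.mem_iUnion, exists_prop, Set.mem_Iio] at h2
          obtain ⟨n, hn, h2⟩ := h2
          simp only [Set.mem_iUnion, exists_prop, Finset.mem_range]
          exact ⟨n, hn, h2.imp (fun h => ⟨h1, h⟩) fun h => ⟨h1, h⟩⟩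
      _ ≤ ∑ n ∈ Finset.range k, (c * (1 / 4) ^ (n + 1) + c * (1 / 4) ^ (n + 1)) := by
          refine (measureReal_biUnion_finset_le _ _).trans (Finset.sum_le_sum fun n _ => ?_)
          refine (measureReal_union_le _ _).trans (add_le_add ?_ ?_)
          · refine (hone _ (by simp)).trans_eq ?_
            congr 2
            simp
          · refine (hone _ (by simp)).trans_eq ?_
            congr 2
            simp
      _ = c * (2 * ∑ n ∈ Finset.range k, (1 / 4) ^ (n + 1)) := by
          rw [Finset.mul_sum, Finset.mul_sum]
          exact Finset.sum_congr rfl fun n _ => by ring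
      _ ≤ c * (2 / 3) := by
          refine mul_le_mul_of_nonneg_left ?_ hc
          linarith [sum_quarter_pow_le k]
  have hmeas : MeasurableSet (crowdedNear X B lam (Set.Iio k) v) :=
    MeasurableSet.biUnion (Set.to_countable _) fun n _ =>
      (sigmaOf_le hX Set.univ _ (measurableSet_crowded hB lam fun _ _ => Set.mem_univ _)).union
        (sigmaOf_le hX Set.univ _ (measurableSet_crowded hB lam fun _ _ => Set.mem_univ _))
  have hsplit := measureReal_inter_add_sdiff (μ := P) (s := X v ⁻¹' C) hmeas
  change _ = c at hsplit
  linarith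

/-- If `C` has uniformly positive probability and `B` is rare enough, then almost surely some vertex
has its value in `C` while fewer than the fraction `lam` of the nearest `n` vertices on either side
have theirs in `B`, for every `n ≥ 1`. The proof looks at the centres `k² + k` of the disjoint
blocks `[k², k² + 2 k]`: what happens inside the blocks is independent, so that it is favourable
infinitely often, whereas crowded prefixes that leave the block occur only finitely often. -/
theorem ae_exists_not_crowded (hX : ∀ u, Measurable (X u)) (hind : iIndepFun X P)
    (hB : MeasurableSet B) (hC : MeasurableSet C) {lam s c : ℝ} (hs : 0 ≤ s)
    (hslam : Real.exp (-s * lam) = 1 / 8) (hPB : ∀ u, P.real (X u ⁻¹' B) ≤ Real.exp (-s))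
    (hc : 0 < c) (hPC : ∀ u, c ≤ P.real (X u ⁻¹' C)) :
    ∀ᵐ ω ∂P, ∃ v : ℤ, X v ω ∈ C ∧ ω ∉ crowdedNear X B lam Set.univ v := by
  have := hind.isProbabilityMeasure
  set w : ℕ → ℤ := fun k => k ^ 2 + k with hw
  set D : ℕ → Set Ω := fun k => X (w k) ⁻¹' C \ crowdedNear X B lam (Set.Iio k) (w k) with hD
  set S : ℕ → Set ℤ := fun k => Set.Ico ((k : ℤ) ^ 2) (((k : ℤ) + 1) ^ 2) with hS
  have hSdisj : Pairwise fun k l => Disjoint (S k) (S l) := by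
    have key : ∀ k l : ℕ, k < l → Disjoint (S k) (S l) := by
      intro k l hkl
      rw [Set.disjoint_left]
      rintro x ⟨_, h2⟩ ⟨h3, _⟩
      have h4 : (k : ℤ) + 1 ≤ l := by exact_mod_cast hkl
      have h5 : (0 : ℤ) ≤ k := by positivity
      nlinarith
    intro k l hkl
    rcases lt_or_gt_of_ne hkl with h | h
    · exact key k l h
    · exact (key l k h).symm
  have hDmeas : ∀ k, MeasurableSet[sigmaOf X (S k)] (D k) := by
    intro k
    refine MeasurableSet.diff (measurable_sigmaOf ?_ hC) ?_
    · simp only [hS, hw, Set.mem_Ico]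
      constructor <;> nlinarith [(by positivity : (0 : ℤ) ≤ k)]
    · refine MeasurableSet.biUnion (Set.to_countable _) fun n hn => ?_
      have hn' : (n : ℤ) + 1 ≤ k := by exact_mod_cast hn
      refine MeasurableSet.union (measurableSet_crowded hB lam fun u hu => ?_)
        (measurableSet_crowded hB lam fun u hu => ?_)
      · rw [Finset.mem_Ioc] at hu
        simp only [hS, hw, Set.mem_Ico] at hu ⊢
        push_cast at hu
        constructor <;> nlinarith
      · rw [Finset.mem_Ico] at hu
        simp only [hS, hw, Set.mem_Ico] at hu ⊢
        push_cast at hu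
        constructor <;> nlinarith
  have hio : ∀ᵐ ω ∂P, ∃ᶠ k in atTop, ω ∈ D k := by
    have h1 : P (limsup D atTop) = 1 := by
      refine measure_limsup_eq_one (fun k => sigmaOf_le hX _ _ (hDmeas k))
        (iIndepSet_of_disjoint hX hind hSdisj hDmeas) ?_
      refine top_unique ?_
      rw [← ENNReal.tsum_const_eq_top_of_ne_zero (α := ℕ) (c := ENNReal.ofReal (c / 3))
        (by rw [Ne, ENNReal.ofReal_eq_zero]; linarith)]
      refine ENNReal.tsum_le_tsum fun k => ?_
      rw [ENNReal.ofReal_le_iff_le_toReal (by finiteness)]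
      refine le_trans ?_ (le_measureReal_sdiff_crowdedNear hX hind hB hC hs hslam hPB k (w k))
      linarith [hPC (w k)]
    have h2 : ∀ᵐ ω ∂P, ω ∈ limsup D atTop :=
      (mem_ae_iff_prob_eq_one (MeasurableSet.measurableSet_limsup
        fun k => sigmaOf_le hX _ _ (hDmeas k))).2 h1
    filter_upwards [h2] with ω hω
    exact mem_limsup_iff_frequently_mem.1 hω
  have hone : ∀ T : Finset ℤ, P (crowded X B lam T) ≤ 4⁻¹ ^ T.card := by
    intro T
    rw [← ENNReal.ofReal_toReal (measure_ne_top P _)]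
    refine (ENNReal.ofReal_le_ofReal
      (measureReal_crowded_le hX hind hB hs hslam hPB T)).trans_eq ?_
    rw [ENNReal.ofReal_pow (by norm_num), one_div, ENNReal.ofReal_inv_of_pos (by norm_num)]
    simp
  have hfar : ∀ᵐ ω ∂P, ∀ᶠ k in atTop, ω ∉ crowdedNear X B lam (Set.Ici k) (w k) := by
    refine ae_eventually_notMem ?_
    have hle : ∀ k : ℕ, P (crowdedNear X B lam (Set.Ici k) (w k))
        ≤ ∑' n : ℕ, 2 * (4⁻¹ ^ k * 4⁻¹ ^ n) := by
      intro k
      have hsub : crowdedNear X B lam (Set.Ici k) (w k) ⊆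
          ⋃ n : ℕ, crowded X B lam (Finset.Ioc (w k) (w k + (k + n + 1 : ℕ))) ∪
            crowded X B lam (Finset.Ico (w k - (k + n + 1 : ℕ)) (w k)) := by
        intro ω hω
        simp only [crowdedNear, Set.mem_iUnion, exists_prop, Set.mem_Ici] at hω
        obtain ⟨n, hn, h⟩ := hω
        obtain ⟨j, rfl⟩ := Nat.exists_eq_add_of_le hn
        exact Set.mem_iUnion.2 ⟨j, h⟩
      refine (measure_mono hsub).trans ((measure_iUnion_le _).trans
        (ENNReal.tsum_le_tsum fun n => ?_))
      have hpow : (4⁻¹ : ENNReal) ^ (k + n + 1) ≤ 4⁻¹ ^ k * 4⁻¹ ^ n := by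
        rw [pow_succ, pow_add]
        exact mul_le_of_le_one_right' (by simp)
      rw [two_mul]
      refine (measure_union_le _ _).trans (add_le_add ?_ ?_)
      · refine (hone _).trans (le_trans (le_of_eq ?_) hpow)
        congr 1
        simp only [Int.card_Ioc]
        omega
      · refine (hone _).trans (le_trans (le_of_eq ?_) hpow)
        congr 1
        simp only [Int.card_Ico]
        omega
    refine ne_top_of_le_ne_top ?_ (ENNReal.tsum_le_tsum hle)
    simp_rw [ENNReal.tsum_mul_left, ENNReal.tsum_mul_right, ENNReal.tsum_geometric]
    have : (1 - 4⁻¹ : ENNReal)⁻¹ ≠ ⊤ := by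
      rw [Ne, ENNReal.inv_eq_top, tsub_eq_zero_iff_le, ENNReal.one_le_inv]
      norm_num
    finiteness
  filter_upwards [hio, hfar] with ω h1 h2
  obtain ⟨k, hk1, hk2⟩ := (h1.and_eventually h2).exists
  refine ⟨w k, hk1.1, fun h => ?_⟩
  simp only [crowdedNear, Set.mem_iUnion, exists_prop] at h
  obtain ⟨n, -, hn⟩ := h
  rcases lt_or_ge n k with hlt | hge
  · exact hk1.2 (Set.mem_biUnion (show n ∈ Set.Iio k from hlt) hn)
  · exact hk2 (Set.mem_biUnion (show n ∈ Set.Ici k from hge) hn)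

end Crowded

end Deffuant

/-! ### Poisson clocks -/

namespace Deffuant

instance nullSingletonClass_expMeasure (r : ℝ) : NullSingletonClass (expMeasure r) := by
  unfold expMeasure gammaMeasure
  infer_instance

lemma expMeasure_Iic_zero {r : ℝ} (hr : 0 < r) : expMeasure r (Set.Iic 0) = 0 := by
  have := isProbabilityMeasure_expMeasure hr
  have h := cdf_expMeasure_eq hr 0
  rw [cdf_eq_real, if_pos le_rfl, mul_zero, neg_zero, Real.exp_zero, sub_self] at h
  exact (measureReal_eq_zero_iff).1 h

lemma expMeasure_Ioi_ne_zero {r : ℝ} (hr : 0 < r) {x : ℝ} (hx : 0 ≤ x) :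
    expMeasure r (Set.Ioi x) ≠ 0 := by
  have := isProbabilityMeasure_expMeasure hr
  have h := cdf_expMeasure_eq hr x
  rw [cdf_eq_real, if_pos hx] at h
  intro h0
  have h1 : (expMeasure r).real (Set.Ioi x) = 0 := by rw [Measure.real, h0, ENNReal.toReal_zero]
  rw [← Set.compl_Iic, probReal_compl_eq_one_sub measurableSet_Iic, h] at h1
  linarith [Real.exp_pos (-(r * x))]

section Clocks

variable {Ω : Type*} [mΩ : MeasurableSpace Ω] {P : Measure Ω}

/-- A random variable without atoms almost surely differs from an independent one. -/
lemma ae_ne_of_indepFun [IsProbabilityMeasure P] {Y Z : Ω → ℝ} (hY : Measurable Y)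
    (hZ : Measurable Z) (hYZ : IndepFun Z Y P) [NullSingletonClass (P.map Y)] :
    ∀ᵐ ω ∂P, Y ω ≠ Z ω := by
  have hprod := (indepFun_iff_map_prod_eq_prod_map_map hZ.aemeasurable hY.aemeasurable).1 hYZ
  have hdiag : MeasurableSet {p : ℝ × ℝ | p.1 = p.2} :=
    measurableSet_eq_fun measurable_fst measurable_snd
  have h0 : (P.map fun ω => (Z ω, Y ω)) {p : ℝ × ℝ | p.1 = p.2} = 0 := by
    have := Measure.isProbabilityMeasure_map (μ := P) hY.aemeasurable
    rw [hprod, Measure.measure_prod_null hdiag]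
    refine Eventually.of_forall fun z => ?_
    have : Prod.mk z ⁻¹' {p : ℝ × ℝ | p.1 = p.2} = {z} := by
      ext y
      simp [eq_comm]
    simp [this]
  rw [Measure.map_apply (hZ.prodMk hY) hdiag] at h0
  rw [ae_iff]
  refine measure_mono_null (fun ω hω => ?_) h0
  simpa [eq_comm] using hω

variable {r : ℝ} {W : ℤ × ℕ → Ω → ℝ}

lemma ae_pos_of_expMeasure (hr : 0 < r) (hW : ∀ p, Measurable (W p))
    (hWlaw : ∀ p, P.map (W p) = expMeasure r) : ∀ᵐ ω ∂P, ∀ p, 0 < W p ω := by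
  refine ae_all_iff.2 fun p => ?_
  have h := expMeasure_Iic_zero hr
  rw [← hWlaw p, Measure.map_apply (hW p) measurableSet_Iic] at h
  rw [ae_iff]
  simp only [not_lt]
  exact h

lemma ae_frequently_lt (hr : 0 < r) (hW : ∀ p, Measurable (W p)) (hWindep : iIndepFun W P)
    (hWlaw : ∀ p, P.map (W p) = expMeasure r) {g : ℕ → ℤ × ℕ} (hg : g.Injective) {x : ℝ}
    (hx : 0 ≤ x) : ∀ᵐ ω ∂P, ∃ᶠ k in atTop, x < W (g k) ω := by
  have := hWindep.isProbabilityMeasure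
  have hm : ∀ k, MeasurableSet (W (g k) ⁻¹' Set.Ioi x) := fun k => hW _ measurableSet_Ioi
  have h1 : P (limsup (fun k => W (g k) ⁻¹' Set.Ioi x) atTop) = 1 := by
    refine measure_limsup_eq_one hm ?_ ?_
    · rw [iIndepSet_iff_meas_biInter hm]
      exact fun s => (hWindep.precomp hg).measure_inter_preimage_eq_mul s
        (sets := fun _ => Set.Ioi x) fun _ _ => measurableSet_Ioi
    · have hc : ∀ k, P (W (g k) ⁻¹' Set.Ioi x) = expMeasure r (Set.Ioi x) := fun k => by
        rw [← hWlaw (g k), Measure.map_apply (hW _) measurableSet_Ioi]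
      simp_rw [hc]
      exact ENNReal.tsum_const_eq_top_of_ne_zero (expMeasure_Ioi_ne_zero hr hx)
  have h2 := (mem_ae_iff_prob_eq_one (MeasurableSet.measurableSet_limsup hm)).2 h1
  filter_upwards [h2] with ω hω
  exact mem_limsup_iff_frequently_mem.1 hω

/-- Positive waiting times that infinitely often exceed `1` have locally finite event times. -/
lemma finite_eventTimes_inter {w : ℕ → ℝ} (hw : ∀ n, 0 < w n) (hlarge : ∃ᶠ n in atTop, 1 < w n)
    (T : ℝ) : (eventTimes w ∩ Set.Ioc 0 T).Finite := by
  have hnot : ¬ Summable w := fun hs => by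
    have := hs.tendsto_atTop_zero.eventually (gt_mem_nhds one_pos)
    obtain ⟨n, h1, h2⟩ := (hlarge.and_eventually this).exists
    linarith
  have htend := (not_summable_iff_tendsto_nat_atTop_of_nonneg fun n => (hw n).le).1 hnot
  obtain ⟨N, hN⟩ := eventually_atTop.1 (htend.eventually_gt_atTop T)
  refine ((Set.finite_Iio N).image fun n => ∑ i ∈ Finset.range (n + 1), w i).subset ?_
  rintro _ ⟨⟨n, rfl⟩, -, hT⟩
  refine ⟨n, ?_, rfl⟩
  by_contra h
  exact (hN (n + 1) (by simp only [Set.mem_Iio, not_lt] at h; omega)).not_ge hT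

lemma disjoint_eventTimes_Ioc {w : ℕ → ℝ} (hw : ∀ n, 0 < w n) {T : ℝ} (hT : T < w 0) :
    Disjoint (eventTimes w) (Set.Ioc 0 T) := by
  rw [Set.disjoint_left]
  rintro _ ⟨n, rfl⟩ ⟨-, h⟩
  have : w 0 ≤ ∑ i ∈ Finset.range (n + 1), w i :=
    Finset.single_le_sum (f := w) (fun i _ => (hw i).le) (by simp)
  exact (hT.trans_le this).not_ge h

/-- Almost surely no two edges have a common event time. -/
lemma ae_disjoint_eventTimes (hW : ∀ p, Measurable (W p)) (hWindep : iIndepFun W P)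
    (hWlaw : ∀ p, P.map (W p) = expMeasure r) :
    ∀ᵐ ω ∂P, ∀ u u', u ≠ u' →
      Disjoint (eventTimes fun n => W (u, n) ω) (eventTimes fun n => W (u', n) ω) := by
  have := hWindep.isProbabilityMeasure
  have key : ∀ᵐ ω ∂P, ∀ (u u' : ℤ) (n n' : ℕ), u ≠ u' →
      ∑ i ∈ Finset.range (n + 1), W (u, i) ω ≠ ∑ i ∈ Finset.range (n' + 1), W (u', i) ω := by
    simp only [ae_all_iff]
    intro u u' n n' huu
    -- isolate the first waiting time on the edge `u`; all others are independent of it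
    set Z : Ω → ℝ := fun ω => ∑ i ∈ Finset.range (n' + 1), W (u', i) ω
      - ∑ i ∈ Finset.range n, W (u, i + 1) ω with hZ
    have hZm : Measurable[sigmaOf W {(u, 0)}ᶜ] Z := by
      refine Measurable.sub (Finset.measurable_sum _ fun i _ => measurable_sigmaOf ?_)
        (Finset.measurable_sum _ fun i _ => measurable_sigmaOf ?_)
      · simp [huu.symm]
      · simp
    have hind : IndepFun Z (W (u, 0)) P := by
      rw [IndepFun_iff_Indep]
      exact indep_of_indep_of_le_left (indep_of_indep_of_le_right
        (indep_sigmaOf hW hWindep (S := {(u, 0)}ᶜ) (T := {(u, 0)}) disjoint_compl_left)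
        (measurable_sigmaOf (Set.mem_singleton _)).comap_le) hZm.comap_le
    have : NullSingletonClass (P.map (W (u, 0))) := hWlaw (u, 0) ▸ nullSingletonClass_expMeasure r
    filter_upwards [ae_ne_of_indepFun (hW (u, 0)) (hZm.mono (sigmaOf_le hW _) le_rfl) hind]
      with ω hω heq
    apply hω
    rw [Finset.sum_range_succ'] at heq
    simp only [hZ]
    linarith
  filter_upwards [key] with ω hω u u' huu
  rw [Set.disjoint_left]
  rintro _ ⟨n, rfl⟩ ⟨n', h⟩
  exact hω u u' n n' huu h.symm

/-- Almost surely, up to any time there are silent edges arbitrarily far out on both sides. -/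
lemma ae_exists_silent (hr : 0 < r) (hW : ∀ p, Measurable (W p)) (hWindep : iIndepFun W P)
    (hWlaw : ∀ p, P.map (W p) = expMeasure r) :
    ∀ᵐ ω ∂P, ∀ (T : ℕ) (v : ℤ), (∃ p : ℕ, 1 ≤ p ∧ (T : ℝ) < W (v + p, 0) ω) ∧
      ∃ q : ℕ, (T : ℝ) < W (v - q - 1, 0) ω := by
  simp only [ae_all_iff]
  intro T v
  have hright := ae_frequently_lt hr hW hWindep hWlaw (g := fun k => (v + k, 0))
    (fun a b h => by simpa using h) T.cast_nonneg
  have hleft := ae_frequently_lt hr hW hWindep hWlaw (g := fun k => (v - k - 1, 0))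
    (fun a b h => by simpa using h) T.cast_nonneg
  filter_upwards [hright, hleft] with ω h1 h2
  obtain ⟨p, h1, hp⟩ := (h1.and_eventually (eventually_ge_atTop 1)).exists
  obtain ⟨q, h2⟩ := h2.exists
  exact ⟨⟨p, hp, h1⟩, q, h2⟩

end Clocks

end Deffuant

/-! ### Initial opinions around a sheltered vertex -/

namespace Deffuant

/-- The uniform distribution on the unit square. -/
noncomputable abbrev squareMeasure : Measure (ℝ × ℝ) :=
  volume.restrict (Set.Icc (0 : ℝ) 1 ×ˢ Set.Icc (0 : ℝ) 1)

lemma squareMeasure_fst_eq_snd : squareMeasure {p : ℝ × ℝ | p.1 = p.2} = 0 := by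
  refine le_antisymm ((Measure.restrict_apply_le _ _).trans ?_) zero_le
  rw [Measure.volume_eq_prod]
  refine ((Measure.measure_prod_null (measurableSet_eq_fun measurable_fst measurable_snd)).2
    (Eventually.of_forall fun y => ?_)).le
  have : Prod.mk y ⁻¹' {p : ℝ × ℝ | p.1 = p.2} = {y} := by
    ext z
    simp [eq_comm]
  simp [this]

/-- The pairs of endpoints with at least one endpoint in `(-∞, δ]`. -/
def meetsIic (δ : ℝ) : Set (ℝ × ℝ) := {p | p.1 ≤ δ ∨ p.2 ≤ δ}

/-- The pairs of endpoints with both endpoints in `(-∞, δ]`. -/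
def insideIic (δ : ℝ) : Set (ℝ × ℝ) := {p | p.1 ≤ δ ∧ p.2 ≤ δ}

lemma measurableSet_meetsIic (δ : ℝ) : MeasurableSet (meetsIic δ) :=
  (measurableSet_le measurable_fst measurable_const).union
    (measurableSet_le measurable_snd measurable_const)

lemma measurableSet_insideIic (δ : ℝ) : MeasurableSet (insideIic δ) :=
  (measurableSet_le measurable_fst measurable_const).inter
    (measurableSet_le measurable_snd measurable_const)

lemma squareMeasure_meetsIic_le {δ : ℝ} (hδ : 0 ≤ δ) :
    squareMeasure.real (meetsIic δ) ≤ 2 * δ := by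
  refine ENNReal.toReal_le_of_le_ofReal (by positivity) ?_
  rw [Measure.restrict_apply (measurableSet_meetsIic δ)]
  have hsub : meetsIic δ ∩ Set.Icc (0 : ℝ) 1 ×ˢ Set.Icc (0 : ℝ) 1 ⊆
      Set.Icc 0 δ ×ˢ Set.Icc 0 1 ∪ Set.Icc 0 1 ×ˢ Set.Icc 0 δ := by
    rintro ⟨y, z⟩ ⟨h1 | h1, h2, h3⟩
    · exact Or.inl ⟨⟨h2.1, h1⟩, h3⟩
    · exact Or.inr ⟨h2, h3.1, h1⟩
  refine (measure_mono hsub).trans ((measure_union_le _ _).trans_eq ?_)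
  rw [Measure.volume_eq_prod, Measure.prod_prod, Measure.prod_prod, Real.volume_Icc,
    Real.volume_Icc, two_mul, ENNReal.ofReal_add hδ hδ]
  simp

lemma le_squareMeasure_insideIic {δ : ℝ} (hδ : 0 ≤ δ) (hδ1 : δ ≤ 1) :
    δ ^ 2 ≤ squareMeasure.real (insideIic δ) := by
  have hfin : squareMeasure (insideIic δ) ≠ ⊤ := by
    refine ne_top_of_le_ne_top ?_ (measure_mono (Set.subset_univ _))
    rw [Measure.restrict_apply_univ, Measure.volume_eq_prod, Measure.prod_prod]
    simp
  rw [Measure.real, ← ENNReal.ofReal_le_iff_le_toReal hfin,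
    Measure.restrict_apply (measurableSet_insideIic δ)]
  have hsub : Set.Icc 0 δ ×ˢ Set.Icc 0 δ ⊆
      insideIic δ ∩ Set.Icc (0 : ℝ) 1 ×ˢ Set.Icc (0 : ℝ) 1 := by
    rintro ⟨y, z⟩ ⟨h1, h2⟩
    exact ⟨⟨h1.2, h2.2⟩, ⟨h1.1, h1.2.trans hδ1⟩, h2.1, h2.2.trans hδ1⟩
  refine le_trans (le_of_eq ?_) (measure_mono hsub)
  rw [Measure.volume_eq_prod, Measure.prod_prod, Real.volume_Icc, sub_zero, sq,
    ENNReal.ofReal_mul hδ]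

/-- Initial opinions whose endpoints are favourable around `v` make `v` sheltered. -/
lemma sheltered_triangularMeasure {Ω : Type*} {U : ℤ → Ω → ℝ × ℝ} {ω : Ω} {δ lam : ℝ} {v : ℤ}
    (hne : ∀ u, (U u ω).1 ≠ (U u ω).2) (hv : U v ω ∈ insideIic δ)
    (hnear : ω ∉ crowdedNear U (meetsIic δ) lam Set.univ v) (p q : ℕ) :
    Sheltered lam (Set.Iic δ) v p q fun u => triangularMeasure (U u ω) := by
  have hle : ∀ u, (triangularMeasure (U u ω)).real (Set.Iic δ) ≤
      (meetsIic δ).indicator (fun _ => (1 : ℝ)) (U u ω) := by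
    intro u
    have := isProbabilityMeasure_triangularMeasure (hne u)
    by_cases h : U u ω ∈ meetsIic δ
    · rw [Set.indicator_of_mem h]
      exact measureReal_le_one
    · rw [Set.indicator_of_notMem h]
      simp only [meetsIic, Set.mem_ofPred_eq, not_or, not_le] at h
      exact (triangularMeasure_real_Iic_eq_zero (hne u) h.1 h.2).le
  simp only [crowdedNear, Set.mem_iUnion, Set.mem_univ, exists_prop, true_and, not_exists,
    Set.mem_union, not_or, crowded, Set.mem_ofPred_eq, not_le] at hnear
  refine ⟨fun u _ _ => isProbabilityMeasure_triangularMeasure (hne u),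
    triangularMeasure_real_Iic_eq_one (hne v) hv.1 hv.2, fun n hn _ => ?_, fun n hn _ => ?_⟩
  · obtain ⟨n, rfl⟩ := Nat.exists_eq_add_of_le' hn
    refine (Finset.sum_le_sum fun (i : ℕ) _ => hle (v + 1 + i)).trans_lt ?_
    have h := (hnear n).1
    have hsum : ∑ i ∈ Finset.range (n + 1),
        (meetsIic δ).indicator (fun _ => (1 : ℝ)) (U (v + 1 + i) ω) =
        ∑ u ∈ Finset.Ioc v (v + (n + 1 : ℕ)),
          (meetsIic δ).indicator (fun _ => (1 : ℝ)) (U u ω) :=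
      Finset.sum_bij (fun i _ => v + 1 + i)
        (fun i hi => by
          have := Finset.mem_range.1 hi
          rw [Finset.mem_Ioc]
          omega)
        (fun i _ j _ hij => by omega)
        (fun u hu => by
          rw [Finset.mem_Ioc] at hu
          exact ⟨(u - v - 1).toNat, Finset.mem_range.2 (by omega), by omega⟩)
        fun _ _ => rfl
    rw [hsum]
    simpa only [Int.card_Ioc, add_sub_cancel_left, Int.toNat_natCast] using h
  · obtain ⟨n, rfl⟩ := Nat.exists_eq_add_of_le' hn
    refine (Finset.sum_le_sum fun (i : ℕ) _ => hle (v - 1 - i)).trans_lt ?_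
    have h := (hnear n).2
    have hsum : ∑ i ∈ Finset.range (n + 1),
        (meetsIic δ).indicator (fun _ => (1 : ℝ)) (U (v - 1 - i) ω) =
        ∑ u ∈ Finset.Ico (v - (n + 1 : ℕ)) v,
          (meetsIic δ).indicator (fun _ => (1 : ℝ)) (U u ω) :=
      Finset.sum_bij (fun i _ => v - 1 - i)
        (fun i hi => by
          have := Finset.mem_range.1 hi
          rw [Finset.mem_Ico]
          omega)
        (fun i _ j _ hij => by omega)
        (fun u hu => by
          rw [Finset.mem_Ico] at hu
          exact ⟨(v - 1 - u).toNat, Finset.mem_range.2 (by omega), by omega⟩)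
        fun _ _ => rfl
    rw [hsum]
    simpa only [Int.card_Ico, sub_sub_cancel, Int.toNat_natCast] using h

end Deffuant

open Deffuant in
theorem theorem3 {Ω : Type*} [MeasurableSpace Ω] (P : Measure Ω) [IsProbabilityMeasure P]
    -- confidence bound, convergence parameter, rate of the Poisson processes
    (θ m r : ℝ) (hθ : θ ∈ Set.Ico (0 : ℝ) 1) (hm : m ∈ Set.Ioc (0 : ℝ) (1 / 2)) (hr : 0 < r)
    -- i.i.d. uniform pairs of endpoints, one for each vertex
    (U : ℤ → Ω → ℝ × ℝ) (hU : ∀ v, Measurable (U v)) (hUindep : iIndepFun U P)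
    (hUlaw : ∀ v, P.map (U v) = volume.restrict (Set.Icc (0 : ℝ) 1 ×ˢ Set.Icc (0 : ℝ) 1))
    -- i.i.d. exponential waiting times, one sequence for each edge
    (W : ℤ × ℕ → Ω → ℝ) (hW : ∀ p, Measurable (W p)) (hWindep : iIndepFun W P)
    (hWlaw : ∀ p, P.map (W p) = expMeasure r)
    -- the encounters are independent of the initial opinions
    (hUW : IndepFun (fun ω v => U v ω) (fun ω p => W p ω) P)
    -- the process of opinions
    (η : ℝ → ℤ → Ω → Measure ℝ)
    (hη : ∀ᵐ ω ∂P, Deffuant.IsTrajectory θ m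
      (fun v => Deffuant.triangularMeasure (U v ω))
      (fun v => Deffuant.eventTimes fun n => W (v, n) ω)
      (fun t v => η t v ω)) :
    ∀ᵐ ω ∂P, Deffuant.ApproachesDisagreement θ (fun t v => η t v ω) := by
  have hlam : 0 < 1 - θ := by linarith [hθ.2]
  -- `s` makes the Chernoff factor `exp (-s lam)` equal to `1 / 8`, and `δ` makes the vertices
  -- whose initial opinion charges `Iic δ` rarer than `exp (-s)`
  obtain ⟨s, hs, hslam⟩ : ∃ s : ℝ, 0 ≤ s ∧ Real.exp (-s * (1 - θ)) = 1 / 8 := by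
    refine ⟨Real.log 8 / (1 - θ), div_nonneg (Real.log_nonneg (by norm_num)) hlam.le, ?_⟩
    rw [neg_mul, div_mul_cancel₀ _ hlam.ne', Real.exp_neg, Real.exp_log (by norm_num), one_div]
  set δ : ℝ := Real.exp (-s) / 2 with hδ
  have hδ0 : 0 < δ := by positivity
  have hδ1 : δ ≤ 1 := by
    have : Real.exp (-s) ≤ 1 := Real.exp_le_one_iff.2 (by linarith)
    linarith
  have hlaw : ∀ (v : ℤ) {A : Set (ℝ × ℝ)}, MeasurableSet A →
      P.real (U v ⁻¹' A) = squareMeasure.real A := fun v A hA => by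
    rw [← map_measureReal_apply (hU v) hA, hUlaw v]
  have hPB : ∀ u, P.real (U u ⁻¹' meetsIic δ) ≤ Real.exp (-s) := fun u => by
    rw [hlaw u (measurableSet_meetsIic δ)]
    exact (squareMeasure_meetsIic_le hδ0.le).trans_eq (by rw [hδ]; ring)
  have hPC : ∀ u, δ ^ 2 ≤ P.real (U u ⁻¹' insideIic δ) := fun u => by
    rw [hlaw u (measurableSet_insideIic δ)]
    exact le_squareMeasure_insideIic hδ0.le hδ1
  have hgood := ae_exists_not_crowded hU hUindep (measurableSet_meetsIic δ)
    (measurableSet_insideIic δ) hs hslam hPB (by positivity) hPC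
  have hne : ∀ᵐ ω ∂P, ∀ u, (U u ω).1 ≠ (U u ω).2 := by
    refine ae_all_iff.2 fun u => ?_
    have h := squareMeasure_fst_eq_snd
    rw [squareMeasure, ← hUlaw u, Measure.map_apply (hU u)
      (measurableSet_eq_fun measurable_fst measurable_snd)] at h
    rw [ae_iff]
    simp only [ne_eq, not_not]
    exact h
  have hlarge : ∀ᵐ ω ∂P, ∀ u : ℤ, ∃ᶠ n in atTop, 1 < W (u, n) ω :=
    ae_all_iff.2 fun u => ae_frequently_lt hr hW hWindep hWlaw (g := fun n => (u, n))
      (fun a b h => by simpa using h) zero_le_one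
  filter_upwards [hgood, hne, hlarge, ae_pos_of_expMeasure hr hW hWlaw,
    ae_disjoint_eventTimes hW hWindep hWlaw, ae_exists_silent hr hW hWindep hWlaw, hη]
    with ω ⟨v, hv, hnear⟩ hneω hlargeω hpos hdisj hsilent htraj
  refine ⟨v, ?_⟩
  filter_upwards [eventually_ge_atTop 0] with t ht
  obtain ⟨T, hT⟩ := exists_nat_ge t
  obtain ⟨⟨p, hp1, hp⟩, q, hq⟩ := hsilent T v
  exact (htraj.sheltered hm measurableSet_Iic
    (fun u => finite_eventTimes_inter (fun n => hpos (u, n)) (hlargeω u) T) hdisj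
    (disjoint_eventTimes_Ioc (fun n => hpos (v + p, n)) hp)
    (disjoint_eventTimes_Ioc (fun n => hpos (v - q - 1, n)) hq)
    (sheltered_triangularMeasure hneω hv hnear p q) ht hT).lt_tvDist_right measurableSet_Iic hp1
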